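/- All groups are additive subgroups of $\mathbb{Q}$-vector spaces. A rational group is an additive subgroup of $\mathbb{Q}$ containing $1$; for rational groups $\sigma,\tau$ one has $\operatorname{type}\sigma\le\operatorname{type}\tau$ if and only if there is a nonzero homomorphism $\sigma\to\tau$. A group is completely decomposable if it is a finite direct sum of rank-one groups. For a group $X$ having a completely decomposable subgroup of finite index, the regulator $\mathrm{R}(X)$ is the intersection of all completely decomposable subgroups of least index in $X$. A decomposition basis of a completely decomposable group $A$ is a linearly independent family $(v_i)$ with $A=\bigoplus_i\tau_iv_i$ for rational groups $\tau_i$. A group is indecomposable if it is nonzero and not the direct sum of two nonzero subgroups. **Lemma.** Let $1\le d\le r\le s$ and let $\tau_1,\dots,\tau_s$ be rational groups with pairwise incomparable types. Let $$A_1=\bigoplus_{i=1}^{r}\tau_iv_i,\qquad A_2=\bigoplus_{i=1}^{d}\tau_iw_i\oplus\bigoplus_{i=r+1}^{s}\tau_iv_i$$ with decomposition bases as displayed, let $e_1,e_2$ be nonzero relatively prime integers, and let $$X_1=A_1+\tfrac{\mathbb Z}{e_1}\sum_{i=1}^{r}\alpha_iv_i,\qquad X_2=A_2+\tfrac{\mathbb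 Z}{e_2}\Big(\sum_{i=1}^{d}\beta_iw_i+\sum_{i=r+1}^{s}\beta_iv_i\Big),$$ where the $\alpha_i,\beta_j$ are integers, every $\alpha_i$ divides $e_1$ and every $\beta_j$ divides $e_2$. Assume that $A_1=\mathrm{R}(X_1)$, $A_2=\mathrm{R}(X_2)$ and that the sum $X_1+X_2=X_1\oplus X_2$ is direct. For $i=1,\dots,d$ put $f_i=\gcd(e_2\alpha_i,e_1\beta_i)$. Then $A_1\oplus A_2=\mathrm{R}(X_1\oplus X_2)$, and there are vectors $v_1',w_1',\dots,v_d',w_d'$ such that $$A_1\oplus A_2=\bigoplus_{i=1}^{d}(\tau_iv_i'\oplus\tau_iw_i')\oplus\bigoplus_{i=d+1}^{s}\tau_iv_i$$ with decomposition basis $\{v_1',w_1',\dots,v_d',w_d',v_{d+1},\dots,v_s\}$, and such that, putting $A=\bigoplus_{i=1}^d\tau_iv_i'\oplus\bigoplus_{i=d+1}^s\tau_iv_i$ and $$Y=A+\tfrac{\mathbb Z}{e_1e_2}\Big(\sum_{i=1}^{d}f_iv_i'+\sum_{i=d+1}^{r}e_2\alpha_iv_i+\sum_{i=r+1}^{s}e_1\beta_iv_i\Big),$$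 the following hold. 1. $X_1\oplus X_2=Y\oplus\tau_1w_1'\oplus\cdots\oplus\tau_dw_d'$. 2. If $X_1$ and $X_2$ are both indecomposable, then so is $Y$. 3. All generator coefficients $f_i$, $e_2\alpha_i$, $e_1\beta_i$ of $Y$ divide $e_1e_2$. 4. The number of summands does not decrease in passing from $X_1\oplus X_2$ to $Y\oplus\tau_1w_1'\oplus\cdots\oplus\tau_dw_d'$: the latter has $1+d\ge2$ nonzero summands, and if $X_1$, $X_2$ and $Y$ are written as direct sums of $n_1$, $n_2$ and $m$ indecomposable groups respectively, then $n_1+n_2\le m+d$. -/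

import Mathlib

/-- A rational group: an additive subgroup of `ℚ` containing `1`. -/
structure RationalGroup where
  carrier : AddSubgroup ℚ
  one_mem : (1 : ℚ) ∈ carrier

/-- The order on types: the type of `σ` is at most the type of `τ` when there is a nonzero
homomorphism `σ → τ`; homomorphisms between rational groups are multiplications by rational
numbers. Two rational groups have incomparable types when this fails in both directions. -/
def RationalGroup.TypeLE (σ τ : RationalGroup) : Prop :=
  ∃ c : ℚ, c ≠ 0 ∧ ∀ x ∈ σ.carrier, c * x ∈ τ.carrier

section Groups

variable {V : Type*} [AddCommGroup V] [Module ℚ V]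

/-- The subgroup `τ v = {x v | x ∈ τ}` of `V`. -/
def RationalGroup.mulVec (τ : RationalGroup) (v : V) : AddSubgroup V :=
  τ.carrier.map (LinearMap.toSpanSingleton ℚ V v).toAddMonoidHom

/-- `G` is the (internal) direct sum of the nonzero subgroups `S i`. -/
structure IsDirectDecomposition {ι : Type*} (G : AddSubgroup V) (S : ι → AddSubgroup V) :
    Prop where
  ne_bot : ∀ i, S i ≠ ⊥
  indep : iSupIndep S
  iSup_eq : ⨆ i, S i = G

/-- `A = ⨁ i, τ i (v i)`, where the vectors `v i` are linearly independent. -/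
structure IsDecompositionBasis {ι : Type*} (A : AddSubgroup V) (τ : ι → RationalGroup)
    (v : ι → V) : Prop where
  linearIndependent : LinearIndependent ℚ v
  eq_iSup : A = ⨆ i, (τ i).mulVec (v i)

/-- The rank of `G` is the dimension of the subspace `ℚ G`. -/
noncomputable def groupRank (G : AddSubgroup V) : ℕ :=
  Module.finrank ℚ (Submodule.span ℚ (G : Set V))

/-- `A` is a finite direct sum of groups of rank one. -/
def IsCompletelyDecomposable (A : AddSubgroup V) : Prop :=
  ∃ (n : ℕ) (L : Fin n → AddSubgroup V),
    (∀ i, groupRank (L i) = 1) ∧ IsDirectDecomposition A L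

/-- `A` is a completely decomposable subgroup of finite index in `X`. -/
structure IsCDFiniteIndex (A X : AddSubgroup V) : Prop where
  le : A ≤ X
  completelyDecomposable : IsCompletelyDecomposable A
  finiteIndex : A.relIndex X ≠ 0

/-- `A` is a regulating subgroup of `X`: a completely decomposable subgroup of least
(finite) index. -/
structure IsRegulating (A X : AddSubgroup V) : Prop where
  cdFiniteIndex : IsCDFiniteIndex A X
  least : ∀ B : AddSubgroup V, IsCDFiniteIndex B X → A.relIndex X ≤ B.relIndex X

/-- The regulator of an almost completely decomposable group `X`: the intersection of its
regulating subgroups. -/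
def regulator (X : AddSubgroup V) : AddSubgroup V :=
  sInf {A | IsRegulating A X}

/-- `G` is nonzero and is not the direct sum of two nonzero subgroups. -/
def IsIndecomposable (G : AddSubgroup V) : Prop :=
  G ≠ ⊥ ∧ ∀ B C : AddSubgroup V, B ⊓ C = ⊥ → B ⊔ C = G → B = ⊥ ∨ C = ⊥

/-- The group `A + (ℤ / e) ∑ i, α i (v i)`. -/
noncomputable def cyclicExtension {ι : Type*} [Fintype ι] (A : AddSubgroup V) (e : ℤ)
    (α : ι → ℤ) (v : ι → V) : AddSubgroup V :=
  A ⊔ AddSubgroup.zmultiples ((e : ℚ)⁻¹ • ∑ i, α i • v i)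

end Groups

/-- The generator coefficients of the merged group: `gcd (e₂ αᵢ, e₁ βᵢ)` on the `d` common
critical types, `e₂ αᵢ` on the `p` types occurring in the first group only and `e₁ βᵢ` on the
`q` types occurring in the second group only. -/
def mergedCoeff {d p q : ℕ} (e₁ e₂ : ℤ) (α : Fin d ⊕ Fin p → ℤ) (β : Fin d ⊕ Fin q → ℤ) :
    Fin d ⊕ (Fin p ⊕ Fin q) → ℤ :=
  Sum.elim (fun i => (Int.gcd (e₂ * α (Sum.inl i)) (e₁ * β (Sum.inl i)) : ℤ))
    (Sum.elim (fun i => e₂ * α (Sum.inr i)) (fun i => e₁ * β (Sum.inr i)))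

/-!
The theorem rests on one change of basis and on one rigidity property.

Change of basis. Put `g₁ = e₁⁻¹ • ∑ αᵢ vᵢ` and `g₂ = e₂⁻¹ • (∑ βᵢ wᵢ + ∑ βᵢ yᵢ)`. Since `e₁` and
`e₂` are coprime, `X₁ ⊕ X₂` is generated by `A₁ ⊕ A₂` and the single element `g₁ + g₂`
(`sup_zmultiples_add`). For each common type, Bézout coefficients for `f i = gcd (e₂ αᵢ, e₁ βᵢ)`
give a unimodular substitution of `v i, w i` by `v' i, w' i` with `f i • v' i = (e₂ αᵢ) • v i +
(e₁ βᵢ) • w i` (`exists_unimodular`, `IsDecompositionBasis.unimodular_change`). As the `w' i` do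
not occur in `g₁ + g₂`, the groups `τ i (w' i)` split off, and what remains is `Y`.

Rigidity. Homomorphisms between rational groups of incomparable types are zero. First, every
completely decomposable subgroup of finite index has homogeneous rank-one summands
(`le_of_isCDFiniteIndex`), hence is contained in any completely decomposable subgroup of finite
index that contains all homogeneous elements; so such a subgroup is the regulator. This
characterization passes from `X₁` and `X₂` to `X₁ ⊕ X₂` (`regulator_sup_eq`). Second, every
endomorphism of `X₁`, `X₂` or `Y` is diagonal in the decomposition basis
(`exists_smul_eq_of_map_mem`). Direct decompositions of these groups are therefore partitions of
their index sets into blocks whose coordinate projections preserve the group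
(`IsDirectDecomposition.exists_block`, `IsDirectDecomposition.coordProj_mem`), and a coordinate
projection that preserves the group cannot split the block of an indecomposable summand
(`IsDirectDecomposition.mem_of_block_eq`).

A set of indices defines compatible coordinate projections on all three groups, and because of
`X₁ ⊕ X₂ = Y ⊕ ⨁ τ i (w' i)` the projection preserves `Y` exactly when it preserves `X₁` and `X₂`
(`map_mem_iff`). If `X₁` and `X₂` are indecomposable, then a set whose projection preserves `Y`
contains all or none of the indices of `X₁`, and all or none of those of `X₂`; as the two groups share an index, it is
trivial, so `Y` is indecomposable. For the number of summands, consider the functions on the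
indices of `Y` that are constant on the blocks of `X₁` and of `X₂`. Their level sets are
preserved, so they are constant on the blocks of `Y` and form a space of dimension at most `m`; on
the other hand they are the pairs in `ℚ^n₁ × ℚ^n₂` satisfying `d` linear conditions
(`card_blocks_le`).
-/

/-! ### Rational spans, projections and coordinates -/

section FiniteIndex

variable {V : Type*} [AddCommGroup V]

theorem IsDirectDecomposition.le {ι : Type*} {X : AddSubgroup V} {S : ι → AddSubgroup V}
    (h : IsDirectDecomposition X S) (i : ι) : S i ≤ X :=
  h.iSup_eq ▸ le_iSup S i

theorem exists_zsmul_mem_of_relIndex {A X : AddSubgroup V} (h : A.relIndex X ≠ 0) :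
    ∃ n : ℤ, n ≠ 0 ∧ ∀ x ∈ X, n • x ∈ A := by
  refine ⟨A.relIndex X, by exact_mod_cast h, fun x hx => ?_⟩
  have := (A.addSubgroupOf X).nsmul_index_mem ⟨x, hx⟩
  rw [natCast_zsmul]
  exact this

theorem relIndex_sup_zmultiples_ne_zero {A : AddSubgroup V} {g : V} {n : ℤ} (hn : n ≠ 0)
    (hg : n • g ∈ A) : A.relIndex (A ⊔ AddSubgroup.zmultiples g) ≠ 0 := by
  rw [sup_comm, AddSubgroup.relIndex_sup_right]
  have h := AddSubgroup.index_comap A (zmultiplesHom V g)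
  rw [AddSubgroup.range_zmultiplesHom] at h
  rw [← h]
  have hle : AddSubgroup.zmultiples n ≤ A.comap (zmultiplesHom V g) := by
    rw [AddSubgroup.zmultiples_le]
    exact hg
  refine fun h0 => hn ?_
  have := AddSubgroup.index_dvd_of_le hle
  rw [h0, zero_dvd_iff, Int.index_zmultiples] at this
  exact Int.natAbs_eq_zero.1 this

end FiniteIndex

section Basics

variable {V : Type*} [AddCommGroup V] [Module ℚ V] {ι : Type*}

/-- A family of values on a linearly independent family extends to a linear map. -/
theorem LinearIndependent.exists_linearMap {W : Type*} [AddCommGroup W] [Module ℚ W] {u : ι → V}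
    (hu : LinearIndependent ℚ u) (g : ι → W) : ∃ L : V →ₗ[ℚ] W, ∀ i, L (u i) = g i := by
  obtain ⟨L, hL⟩ := LinearMap.exists_extend ((Module.Basis.span hu).constr ℚ g)
  refine ⟨L, fun i => ?_⟩
  have h := LinearMap.congr_fun hL (Module.Basis.span hu i)
  rw [Module.Basis.constr_basis, LinearMap.comp_apply, Submodule.subtype_apply,
    Module.Basis.span_apply] at h
  exact h

theorem exists_zsmul_mem_of_mem_span {B : AddSubgroup V} {z : V}
    (hz : z ∈ Submodule.span ℚ (B : Set V)) : ∃ n : ℤ, n ≠ 0 ∧ n • z ∈ B := by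
  induction hz using Submodule.span_induction with
  | mem x hx => exact ⟨1, one_ne_zero, by simpa using hx⟩
  | zero => exact ⟨1, one_ne_zero, by simp⟩
  | add x y _ _ hx hy =>
    obtain ⟨m, hm, hmx⟩ := hx
    obtain ⟨n, hn, hny⟩ := hy
    refine ⟨m * n, mul_ne_zero hm hn, ?_⟩
    rw [smul_add, mul_smul m n y, mul_comm, mul_smul]
    exact add_mem (B.zsmul_mem hmx n) (B.zsmul_mem hny m)
  | smul q x _ hx =>
    obtain ⟨m, hm, hmx⟩ := hx
    refine ⟨q.den * m, mul_ne_zero (by exact_mod_cast q.den_nz) hm, ?_⟩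
    have : ((q.den : ℤ) * m) • q • x = q.num • m • x := by
      rw [← Int.cast_smul_eq_zsmul ℚ, ← Int.cast_smul_eq_zsmul ℚ q.num,
        ← Int.cast_smul_eq_zsmul ℚ m, smul_smul, smul_smul]
      congr 1
      push_cast
      rw [mul_right_comm, mul_comm (q.den : ℚ), Rat.mul_den_eq_num]
    rw [this]
    exact B.zsmul_mem hmx _

theorem disjoint_span_of_inf_eq_bot {B C : AddSubgroup V} (h : B ⊓ C = ⊥) :
    Disjoint (Submodule.span ℚ (B : Set V)) (Submodule.span ℚ (C : Set V)) := by
  rw [Submodule.disjoint_def]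
  intro z hB hC
  obtain ⟨m, hm, hmB⟩ := exists_zsmul_mem_of_mem_span hB
  obtain ⟨n, hn, hnC⟩ := exists_zsmul_mem_of_mem_span hC
  have hmem : (m * n) • z ∈ B ⊓ C :=
    ⟨by rw [mul_comm, mul_smul]; exact B.zsmul_mem hmB n,
      by rw [mul_smul]; exact C.zsmul_mem hnC m⟩
  rw [h, AddSubgroup.mem_bot, ← Int.cast_smul_eq_zsmul ℚ, smul_eq_zero] at hmem
  exact hmem.resolve_left (by exact_mod_cast mul_ne_zero hm hn)

/-- Two subgroups with trivial intersection are separated by a linear projection of the ambient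
space. -/
theorem exists_projection_of_inf_eq_bot {B C : AddSubgroup V} (h : B ⊓ C = ⊥) :
    ∃ P : V →ₗ[ℚ] V, (∀ z ∈ B, P z = z) ∧ ∀ z ∈ C, P z = 0 := by
  obtain ⟨D, hD, hc⟩ := (disjoint_span_of_inf_eq_bot h).exists_isCompl
  refine ⟨D.subtype ∘ₗ Submodule.projectionOnto _ _ hc, fun z hz => ?_, fun z hz => ?_⟩
  · have hzD := hD (Submodule.subset_span hz)
    have := Submodule.projectionOnto_apply_left hc ⟨z, hzD⟩
    simp only [LinearMap.comp_apply]
    rw [this]; rfl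
  · have := (Submodule.projectionOnto_apply_eq_zero_iff hc).2 (Submodule.subset_span hz)
    simp [this]

theorem iSupIndep_of_projections {S : ι → AddSubgroup V} (P : ι → V →ₗ[ℚ] V)
    (h1 : ∀ i, ∀ z ∈ S i, P i z = z) (h0 : ∀ i j, j ≠ i → ∀ z ∈ S j, P i z = 0) :
    iSupIndep S := by
  intro i
  rw [AddSubgroup.disjoint_def]
  intro z hz hz'
  have hle : (⨆ j, ⨆ (_ : j ≠ i), S j) ≤ (P i).toAddMonoidHom.ker :=
    iSup₂_le fun j hj z hz => h0 i j hj z hz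
  rw [← h1 i z hz]
  exact hle hz'

theorem IsDirectDecomposition.exists_projections {X : AddSubgroup V} {S : ι → AddSubgroup V}
    (h : IsDirectDecomposition X S) : ∃ P : ι → V →ₗ[ℚ] V,
      (∀ i, ∀ z ∈ S i, P i z = z) ∧ (∀ i j, j ≠ i → ∀ z ∈ S j, P i z = 0) ∧
      ∀ i, ∀ z ∈ X, P i z ∈ S i := by
  choose P hP1 hP0 using fun i => exists_projection_of_inf_eq_bot (h.indep i).eq_bot
  have h0 : ∀ i j, j ≠ i → ∀ z ∈ S j, P i z = 0 := fun i j hj z hz =>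
    hP0 i z (le_iSup₂ (f := fun j (_ : j ≠ i) => S j) j hj hz)
  refine ⟨P, hP1, h0, fun i z hz => ?_⟩
  rw [← h.iSup_eq] at hz
  have hle : (⨆ j, S j) ≤ (S i).comap (P i).toAddMonoidHom := by
    refine iSup_le fun j z hz => ?_
    rcases eq_or_ne j i with rfl | hj
    · change P j z ∈ S j
      rwa [hP1 j z hz]
    · change P i z ∈ S i
      rw [h0 i j hj z hz]
      exact (S i).zero_mem
  exact hle hz

theorem RationalGroup.self_mem_mulVec (τ : RationalGroup) (v : V) : v ∈ τ.mulVec v :=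
  ⟨1, τ.one_mem, one_smul ℚ v⟩

theorem RationalGroup.mulVec_ne_bot (τ : RationalGroup) {v : V} (hv : v ≠ 0) :
    τ.mulVec v ≠ ⊥ := fun h =>
  hv (AddSubgroup.mem_bot.1 (h ▸ τ.self_mem_mulVec v))

theorem RationalGroup.mulVec_le_span (τ : RationalGroup) (v : V) :
    τ.mulVec v ≤ (Submodule.span ℚ {v}).toAddSubgroup := by
  rintro _ ⟨c, _, rfl⟩
  exact Submodule.smul_mem _ c (Submodule.mem_span_singleton_self v)

theorem RationalGroup.mulVec_add_le (τ : RationalGroup) (a b : ℤ) (v w : V) :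
    τ.mulVec ((a : ℚ) • v + (b : ℚ) • w) ≤ τ.mulVec v ⊔ τ.mulVec w := by
  rintro _ ⟨c, hc, rfl⟩
  refine AddSubgroup.mem_sup.2 ⟨_, ⟨c * a, ?_, rfl⟩, _, ⟨c * b, ?_, rfl⟩, ?_⟩
  · rw [mul_comm, ← zsmul_eq_mul]; exact τ.carrier.zsmul_mem hc a
  · rw [mul_comm, ← zsmul_eq_mul]; exact τ.carrier.zsmul_mem hc b
  · simp [mul_smul]

namespace IsDecompositionBasis

variable {A : AddSubgroup V} {T : ι → RationalGroup} {u : ι → V}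

theorem mulVec_le (hA : IsDecompositionBasis A T u) (i : ι) : (T i).mulVec (u i) ≤ A := by
  rw [hA.eq_iSup]
  exact le_iSup (fun i => (T i).mulVec (u i)) i

theorem vec_mem (hA : IsDecompositionBasis A T u) (i : ι) : u i ∈ A :=
  hA.mulVec_le i ((T i).self_mem_mulVec (u i))

theorem le_span (hA : IsDecompositionBasis A T u) :
    A ≤ (Submodule.span ℚ (Set.range u)).toAddSubgroup := by
  rw [hA.eq_iSup]
  refine iSup_le fun i => ((T i).mulVec_le_span (u i)).trans ?_
  exact Submodule.span_mono (Set.singleton_subset_iff.2 ⟨i, rfl⟩)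

theorem exists_coord [Fintype ι] (hA : IsDecompositionBasis A T u) :
    ∃ c : V →ₗ[ℚ] ι → ℚ, (∀ z ∈ Submodule.span ℚ (Set.range u), ∑ i, c z i • u i = z) ∧
      ∀ z ∈ A, ∀ j, c z j ∈ (T j).carrier := by
  classical
  obtain ⟨c, hc⟩ := hA.linearIndependent.exists_linearMap (fun i => (Pi.single i 1 : ι → ℚ))
  refine ⟨c, fun z hz => ?_, fun z hz j => ?_⟩
  · let L : V →ₗ[ℚ] V := (Fintype.linearCombination ℚ u) ∘ₗ c
    have := LinearMap.eqOn_span (f := L) (g := LinearMap.id) (s := Set.range u) (by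
      rintro _ ⟨i, rfl⟩
      simp [L, hc, Fintype.linearCombination_apply_single]) hz
    simpa [L, Fintype.linearCombination_apply] using this
  · have hle : A ≤ (T j).carrier.comap ((LinearMap.proj j ∘ₗ c : V →ₗ[ℚ] ℚ)).toAddMonoidHom := by
      rw [hA.eq_iSup]
      refine iSup_le ?_
      rintro i _ ⟨a, ha, rfl⟩
      simp only [AddSubgroup.mem_comap, LinearMap.toAddMonoidHom_coe, LinearMap.comp_apply,
        LinearMap.proj_apply, LinearMap.toSpanSingleton_apply, map_smul, hc]
      rcases eq_or_ne j i with rfl | hj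
      · simpa using ha
      · rw [Pi.single_eq_of_ne hj]; simp
    exact hle hz

theorem sup {ι' : Type*} {A' : AddSubgroup V} {T' : ι' → RationalGroup} {u' : ι' → V}
    (hA : IsDecompositionBasis A T u) (hA' : IsDecompositionBasis A' T' u') (hinf : A ⊓ A' = ⊥) :
    IsDecompositionBasis (A ⊔ A') (Sum.elim T T') (Sum.elim u u') := by
  constructor
  · exact hA.linearIndependent.sum_type hA'.linearIndependent
      ((disjoint_span_of_inf_eq_bot hinf).mono
        (Submodule.span_mono (Set.range_subset_iff.2 hA.vec_mem))
        (Submodule.span_mono (Set.range_subset_iff.2 hA'.vec_mem)))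
  · rw [hA.eq_iSup, hA'.eq_iSup, iSup_sum]
    rfl

end IsDecompositionBasis

theorem mem_span_of_relIndex {A X : AddSubgroup V} {T : ι → RationalGroup} {u : ι → V}
    (hA : IsDecompositionBasis A T u) (hfin : A.relIndex X ≠ 0) {x : V} (hx : x ∈ X) :
    x ∈ Submodule.span ℚ (Set.range u) := by
  obtain ⟨n, hn, h⟩ := exists_zsmul_mem_of_relIndex hfin
  have hmem : n • x ∈ Submodule.span ℚ (Set.range u) := hA.le_span (h x hx)
  rw [← Int.cast_smul_eq_zsmul ℚ] at hmem
  exact (Submodule.smul_mem_iff _ (by exact_mod_cast hn)).1 hmem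

end Basics

/-! ### The regulator -/

section Regulator

variable {V : Type*} [AddCommGroup V] [Module ℚ V] {ι κ : Type*}

theorem groupRank_eq_one_of_le_span {L : AddSubgroup V} {u : V} (hu : u ≠ 0) (huL : u ∈ L)
    (hL : L ≤ (Submodule.span ℚ {u}).toAddSubgroup) : groupRank L = 1 := by
  have : Submodule.span ℚ (L : Set V) = Submodule.span ℚ {u} :=
    le_antisymm (Submodule.span_le.2 hL)
      (Submodule.span_mono (Set.singleton_subset_iff.2 huL))
  rw [groupRank, this, finrank_span_singleton hu]

theorem exists_smul_eq_of_groupRank_eq_one {L : AddSubgroup V} (h : groupRank L = 1) {z y : V}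
    (hz : z ∈ L) (hz0 : z ≠ 0) (hy : y ∈ L) : ∃ t : ℚ, y = t • z := by
  have hz' : (⟨z, Submodule.subset_span hz⟩ : Submodule.span ℚ (L : Set V)) ≠ 0 := by
    simpa using hz0
  obtain ⟨t, ht⟩ := (finrank_eq_one_iff_of_nonzero' _ hz').1 h ⟨y, Submodule.subset_span hy⟩
  exact ⟨t, (congrArg Subtype.val ht).symm⟩

/-- The sum of rank-one groups, one on each line of a linearly independent family, is completely
decomposable. -/
theorem isCompletelyDecomposable_iSup [Fintype ι] {u : ι → V} (hu : LinearIndependent ℚ u)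
    {L : ι → AddSubgroup V} (huL : ∀ i, u i ∈ L i)
    (hL : ∀ i, L i ≤ (Submodule.span ℚ {u i}).toAddSubgroup) :
    IsCompletelyDecomposable (⨆ i, L i) := by
  classical
  have hindep : iSupIndep L := by
    choose P hP using fun i => hu.exists_linearMap (fun j => if j = i then u j else 0)
    refine iSupIndep_of_projections P (fun i z hz => ?_) (fun i j hj z hz => ?_)
    · obtain ⟨c, rfl⟩ := Submodule.mem_span_singleton.1 (hL i hz)
      simp [hP]
    · obtain ⟨c, rfl⟩ := Submodule.mem_span_singleton.1 (hL j hz)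
      simp [hP, hj]
  let e := (Fintype.equivFin ι).symm
  refine ⟨Fintype.card ι, L ∘ e, fun i => ?_, fun i h => ?_, hindep.comp e.injective,
    e.surjective.iSup_comp L⟩
  · exact groupRank_eq_one_of_le_span (hu.ne_zero _) (huL _) (hL _)
  · exact hu.ne_zero (e i) (AddSubgroup.mem_bot.1 (h ▸ huL (e i)))

theorem IsDecompositionBasis.isCompletelyDecomposable [Fintype ι] {A : AddSubgroup V}
    {T : ι → RationalGroup} {u : ι → V} (hA : IsDecompositionBasis A T u) :
    IsCompletelyDecomposable A := by
  rw [hA.eq_iSup]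
  exact isCompletelyDecomposable_iSup hA.linearIndependent
    (fun i => (T i).self_mem_mulVec _) (fun i => (T i).mulVec_le_span _)

/-- Every rank-one summand `L` of a completely decomposable subgroup of finite index is homogeneous
with respect to `A`: a projection onto `L` gives a nonzero homomorphism from some `T i` to `L`, and
`L` maps nontrivially to `T j` for each coordinate `j` in its support, so that all these `j` belong
to the class of `i`. -/
theorem le_of_isCDFiniteIndex [Fintype ι] {X A C B : AddSubgroup V} {T : ι → RationalGroup}
    {u : ι → V} (hA : IsDecompositionBasis A T u) (hAX : A ≤ X) (hfin : A.relIndex X ≠ 0)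
    (cl : ι → κ) (hcl : ∀ i j, (T i).TypeLE (T j) → cl i = cl j)
    (hpure : ∀ k, ∀ x ∈ X, x ∈ Submodule.span ℚ (u '' {i | cl i = k}) → x ∈ C)
    (hB : IsCDFiniteIndex B X) : B ≤ C := by
  obtain ⟨m, L, hrank, hL⟩ := hB.completelyDecomposable
  obtain ⟨P, hP1, -, hPL⟩ := hL.exists_projections
  obtain ⟨n, hn, hnA⟩ := exists_zsmul_mem_of_relIndex hfin
  obtain ⟨N, hN, hNB⟩ := exists_zsmul_mem_of_relIndex hB.finiteIndex
  obtain ⟨c, hc, hcT⟩ := hA.exists_coord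
  rw [← hL.iSup_eq]
  refine iSup_le fun k z hz => ?_
  rcases eq_or_ne z 0 with rfl | hz0
  · exact C.zero_mem
  have hzX : z ∈ X := hB.le (hL.le k hz)
  have hzspan := mem_span_of_relIndex hA hfin hzX
  obtain ⟨i, hi⟩ : ∃ i, P k (u i) ≠ 0 := by
    by_contra! h
    have := LinearMap.eqOn_span (f := P k) (g := 0) (s := Set.range u)
      (by rintro _ ⟨i, rfl⟩; simpa using h i) hzspan
    rw [hP1 k z hz] at this
    exact hz0 this
  have hPmem : ∀ x ∈ (T i).carrier, (N : ℚ) • x • P k (u i) ∈ L k := fun x hx => by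
    rw [← map_smul, ← map_smul, Int.cast_smul_eq_zsmul]
    exact hPL k _ (hNB _ (hAX (hA.mulVec_le i ⟨x, hx, rfl⟩)))
  obtain ⟨t, ht⟩ := exists_smul_eq_of_groupRank_eq_one (hrank k) hz hz0
    (hPmem 1 (T i).one_mem)
  have hN' : (N : ℚ) ≠ 0 := by exact_mod_cast hN
  have hn' : (n : ℚ) ≠ 0 := by exact_mod_cast hn
  rw [one_smul] at ht
  have ht0 : t ≠ 0 := by
    rintro rfl
    rw [zero_smul, smul_eq_zero] at ht
    exact ht.elim hN' hi
  refine hpure (cl i) z hzX ?_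
  rw [← hc z hzspan]
  refine Submodule.sum_mem _ fun j _ => ?_
  rcases eq_or_ne (c z j) 0 with h0 | h0
  · rw [h0, zero_smul]; exact Submodule.zero_mem _
  refine Submodule.smul_mem _ _ (Submodule.subset_span ⟨j, (hcl i j ?_).symm, rfl⟩)
  refine ⟨n * t * c z j, mul_ne_zero (mul_ne_zero hn' ht0) h0, fun x hx => ?_⟩
  have h1 := hcT _ (hnA _ (hB.le (hL.le k (hPmem x hx)))) j
  rw [smul_comm (N : ℚ) x, ht, ← Int.cast_smul_eq_zsmul ℚ] at h1
  simp only [map_smul, Pi.smul_apply, smul_eq_mul] at h1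
  convert h1 using 1
  ring

theorem regulator_eq_of_forall_le {X C : AddSubgroup V} (hC : IsCDFiniteIndex C X)
    (hle : ∀ B, IsCDFiniteIndex B X → B ≤ C) : regulator X = C := by
  have hleast : ∀ B, IsCDFiniteIndex B X → C.relIndex X ≤ B.relIndex X := fun B hB =>
    Nat.le_of_dvd (Nat.pos_of_ne_zero hB.finiteIndex)
      (AddSubgroup.relIndex_dvd_of_le_left X (hle B hB))
  refine le_antisymm (sInf_le ⟨hC, hleast⟩) (le_sInf fun B hB => ?_)
  have hBC := hle B hB.cdFiniteIndex
  have heq : B.relIndex X = C.relIndex X := le_antisymm (hB.least C hC) (hleast B hB.cdFiniteIndex)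
  have hmul := AddSubgroup.relIndex_mul_relIndex B C X hBC hC.le
  rw [heq] at hmul
  exact AddSubgroup.relIndex_eq_one.1
    (Nat.eq_of_mul_eq_mul_right (Nat.pos_of_ne_zero hC.finiteIndex) (by rw [hmul, one_mul]))

/-- If the types are pairwise incomparable, the regulator contains every element of the group that
lies on one of the lines `ℚ (u i)`. -/
theorem mem_regulator_of_mem_span [Fintype ι] {X A : AddSubgroup V} {T : ι → RationalGroup}
    {u : ι → V} (hA : IsDecompositionBasis A T u) (hAX : A ≤ X) (hfin : A.relIndex X ≠ 0)
    (hT : Pairwise fun i j => ¬ (T i).TypeLE (T j)) {i : ι} {x : V} (hx : x ∈ X)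
    (hxu : x ∈ Submodule.span ℚ {u i}) : x ∈ regulator X := by
  -- The regulator is the sum of the pure rank-one subgroups generated by the `u i`.
  let L : ι → AddSubgroup V := fun i => X ⊓ (Submodule.span ℚ {u i}).toAddSubgroup
  have hAL : A ≤ ⨆ i, L i := by
    rw [hA.eq_iSup]
    exact iSup_mono fun i => le_inf ((hA.mulVec_le i).trans hAX) ((T i).mulVec_le_span _)
  have hC : IsCDFiniteIndex (⨆ i, L i) X :=
    ⟨iSup_le fun i => inf_le_left,
      isCompletelyDecomposable_iSup hA.linearIndependent
        (fun i => ⟨hAX (hA.vec_mem i), Submodule.mem_span_singleton_self _⟩)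
        (fun i => inf_le_right),
      fun h => hfin (Nat.eq_zero_of_zero_dvd
        (h ▸ AddSubgroup.relIndex_dvd_of_le_left X hAL))⟩
  rw [regulator_eq_of_forall_le hC fun B hB =>
    le_of_isCDFiniteIndex hA hAX hfin id (fun i j h => not_imp_comm.1 (@hT i j) (not_not.2 h))
      (fun k x hx hxk => ?_) hB]
  · exact AddSubgroup.mem_iSup_of_mem i ⟨hx, hxu⟩
  · refine AddSubgroup.mem_iSup_of_mem k ⟨hx, ?_⟩
    simpa using hxk

/-- The regulator of a direct sum is the sum of the regulators. The types within `A₁` are pairwise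
incomparable, as are those within `A₂`; a type of `A₁` may be comparable to at most one type of
`A₂`, and `cl₁` and `cl₂` assign the same value to the two members of such a pair. -/
theorem regulator_sup_eq {ι₁ ι₂ : Type*} [Fintype ι₁] [Fintype ι₂] {X₁ X₂ A₁ A₂ : AddSubgroup V}
    {T₁ : ι₁ → RationalGroup} {T₂ : ι₂ → RationalGroup} {u₁ : ι₁ → V} {u₂ : ι₂ → V}
    (hA₁ : IsDecompositionBasis A₁ T₁ u₁) (hA₂ : IsDecompositionBasis A₂ T₂ u₂)
    (hle₁ : A₁ ≤ X₁) (hle₂ : A₂ ≤ X₂)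
    (hfin₁ : A₁.relIndex X₁ ≠ 0) (hfin₂ : A₂.relIndex X₂ ≠ 0)
    (hfin : (A₁ ⊔ A₂).relIndex (X₁ ⊔ X₂) ≠ 0)
    (hR₁ : A₁ = regulator X₁) (hR₂ : A₂ = regulator X₂) (hdirect : X₁ ⊓ X₂ = ⊥)
    {cl₁ : ι₁ → κ} {cl₂ : ι₂ → κ} (hcl₁ : Function.Injective cl₁) (hcl₂ : Function.Injective cl₂)
    (hcl : ∀ i j, (Sum.elim T₁ T₂ i).TypeLE (Sum.elim T₁ T₂ j) →
      Sum.elim cl₁ cl₂ i = Sum.elim cl₁ cl₂ j) :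
    A₁ ⊔ A₂ = regulator (X₁ ⊔ X₂) := by
  have hT₁ : Pairwise fun i j => ¬ (T₁ i).TypeLE (T₁ j) := fun i j hij h =>
    hij (hcl₁ (hcl (Sum.inl i) (Sum.inl j) h))
  have hT₂ : Pairwise fun i j => ¬ (T₂ i).TypeLE (T₂ j) := fun i j hij h =>
    hij (hcl₂ (hcl (Sum.inr i) (Sum.inr j) h))
  obtain ⟨P₁, hP₁, hP₁'⟩ := exists_projection_of_inf_eq_bot hdirect
  obtain ⟨P₂, hP₂, hP₂'⟩ := exists_projection_of_inf_eq_bot (inf_comm X₁ X₂ ▸ hdirect)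
  have hle := sup_le_sup hle₁ hle₂
  have hA := hA₁.sup hA₂ (le_bot_iff.1 (hdirect ▸ inf_le_inf hle₁ hle₂))
  refine (regulator_eq_of_forall_le ⟨hle, hA.isCompletelyDecomposable, hfin⟩ fun B hB =>
    le_of_isCDFiniteIndex hA hle hfin (Sum.elim cl₁ cl₂) hcl (fun k z hz hzk => ?_) hB).symm
  obtain ⟨z₁, hz₁, z₂, hz₂, rfl⟩ := AddSubgroup.mem_sup.1 hz
  have key : ∀ P : V →ₗ[ℚ] V, P (z₁ + z₂) ∈ Submodule.span ℚ
      (P '' (Sum.elim u₁ u₂ '' {i | Sum.elim cl₁ cl₂ i = k})) := fun P => by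
    rw [Submodule.span_image]; exact Submodule.mem_map_of_mem hzk
  refine add_mem ((le_sup_left : A₁ ≤ _) ?_) ((le_sup_right : A₂ ≤ _) ?_)
  · have h := key P₁
    rw [map_add, hP₁ z₁ hz₁, hP₁' z₂ hz₂, add_zero] at h
    by_cases hk : ∃ i, cl₁ i = k
    · obtain ⟨i, rfl⟩ := hk
      rw [hR₁]
      refine mem_regulator_of_mem_span hA₁ hle₁ hfin₁ hT₁ hz₁ (i := i) ?_
      refine Submodule.span_le.2 ?_ h
      rintro _ ⟨_, ⟨j | j, hj, rfl⟩, rfl⟩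
      · rw [hcl₁ hj]
        simp [hP₁ _ (hle₁ (hA₁.vec_mem i))]
      · simp [hP₁' _ (hle₂ (hA₂.vec_mem j))]
    · have h0 : z₁ ∈ (⊥ : Submodule ℚ V) := by
        refine Submodule.span_le.2 ?_ h
        rintro _ ⟨_, ⟨j | j, hj, rfl⟩, rfl⟩
        · exact (hk ⟨j, hj⟩).elim
        · simp [hP₁' _ (hle₂ (hA₂.vec_mem j))]
      rw [(Submodule.mem_bot ℚ).1 h0]
      exact A₁.zero_mem
  · have h := key P₂
    rw [map_add, hP₂ z₂ hz₂, hP₂' z₁ hz₁, zero_add] at h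
    by_cases hk : ∃ i, cl₂ i = k
    · obtain ⟨i, rfl⟩ := hk
      rw [hR₂]
      refine mem_regulator_of_mem_span hA₂ hle₂ hfin₂ hT₂ hz₂ (i := i) ?_
      refine Submodule.span_le.2 ?_ h
      rintro _ ⟨_, ⟨j | j, hj, rfl⟩, rfl⟩
      · simp [hP₂' _ (hle₁ (hA₁.vec_mem j))]
      · rw [hcl₂ hj]
        simp [hP₂ _ (hle₂ (hA₂.vec_mem i))]
    · have h0 : z₂ ∈ (⊥ : Submodule ℚ V) := by
        refine Submodule.span_le.2 ?_ h
        rintro _ ⟨_, ⟨j | j, hj, rfl⟩, rfl⟩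
        · simp [hP₂' _ (hle₁ (hA₁.vec_mem j))]
        · exact (hk ⟨j, hj⟩).elim
      rw [(Submodule.mem_bot ℚ).1 h0]
      exact A₂.zero_mem

end Regulator

/-! ### Direct decompositions and partitions of the decomposition basis -/

section Blocks

variable {V : Type*} [AddCommGroup V] [Module ℚ V] {ι κ : Type*}

/-- On the vectors `u i`, the map `D` is the coordinate projection that keeps the indices in `E`;
nothing is required of `D` outside the span of these vectors. -/
def IsCoordProj (D : V →ₗ[ℚ] V) (E : Set ι) (u : ι → V) : Prop :=
  ∀ i, (i ∈ E → D (u i) = u i) ∧ (i ∉ E → D (u i) = 0)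

theorem eq_of_mem_span_range {u : ι → V} {f g : V →ₗ[ℚ] V} (h : ∀ i, f (u i) = g (u i)) {x : V}
    (hx : x ∈ Submodule.span ℚ (Set.range u)) : f x = g x :=
  LinearMap.eqOn_span (by rintro _ ⟨i, rfl⟩; exact h i) hx

theorem IsCoordProj.idem {D : V →ₗ[ℚ] V} {E : Set ι} {u : ι → V} (hD : IsCoordProj D E u) {x : V}
    (hx : x ∈ Submodule.span ℚ (Set.range u)) : D (D x) = D x := by
  refine eq_of_mem_span_range (f := D ∘ₗ D) (g := D) (fun i => ?_) hx
  by_cases hi : i ∈ E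
  · simp [(hD i).1 hi]
  · simp [(hD i).2 hi]

theorem IsCoordProj.map_mem_span {D : V →ₗ[ℚ] V} {E : Set ι} {u : ι → V} (hD : IsCoordProj D E u)
    {x : V} (hx : x ∈ Submodule.span ℚ (Set.range u)) :
    D x ∈ Submodule.span ℚ (Set.range u) := by
  have hle : Submodule.span ℚ (Set.range u) ≤ (Submodule.span ℚ (Set.range u)).comap D := by
    refine Submodule.span_le.2 ?_
    rintro _ ⟨i, rfl⟩
    by_cases hi : i ∈ E
    · simpa [(hD i).1 hi] using Submodule.subset_span (Set.mem_range_self i)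
    · simp [(hD i).2 hi]
  exact hle hx

/-- An idempotent endomorphism of an indecomposable group is trivial. -/
theorem IsIndecomposable.eq_zero_or_eq_id {G : AddSubgroup V} (hG : IsIndecomposable G)
    {D : V →ₗ[ℚ] V} (hD : ∀ x ∈ G, D x ∈ G) (hidem : ∀ x ∈ G, D (D x) = D x) :
    (∀ x ∈ G, D x = 0) ∨ ∀ x ∈ G, D x = x := by
  let B : AddSubgroup V := G ⊓ (D - LinearMap.id).toAddMonoidHom.ker
  let C : AddSubgroup V := G ⊓ D.toAddMonoidHom.ker
  have hB : ∀ {x}, x ∈ B ↔ x ∈ G ∧ D x = x := by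
    intro x
    simp [B, AddMonoidHom.mem_ker, sub_eq_zero]
  have hC : ∀ {x}, x ∈ C ↔ x ∈ G ∧ D x = 0 := by
    intro x
    simp [C, AddMonoidHom.mem_ker]
  have hBmem : ∀ x ∈ G, D x ∈ B := fun x hx => hB.2 ⟨hD x hx, hidem x hx⟩
  have hCmem : ∀ x ∈ G, x - D x ∈ C := fun x hx =>
    hC.2 ⟨sub_mem hx (hD x hx), by rw [map_sub, hidem x hx, sub_self]⟩
  have hinf : B ⊓ C = ⊥ := by
    refine (AddSubgroup.eq_bot_iff_forall _).2 fun x hx => ?_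
    rw [← (hB.1 hx.1).2, (hC.1 hx.2).2]
  have hsup : B ⊔ C = G := le_antisymm (sup_le inf_le_left inf_le_left) fun x hx =>
    AddSubgroup.mem_sup.2 ⟨D x, hBmem x hx, x - D x, hCmem x hx, add_sub_cancel _ _⟩
  rcases hG.2 B C hinf hsup with h | h
  · exact Or.inl fun x hx => AddSubgroup.mem_bot.1 (h ▸ hBmem x hx)
  · exact Or.inr fun x hx => (sub_eq_zero.1 (AddSubgroup.mem_bot.1 (h ▸ hCmem x hx))).symm

/-- An endomorphism is diagonal in the decomposition basis, because there is no nonzero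
homomorphism `T i → T j` for `i ≠ j`. -/
theorem exists_smul_eq_of_map_mem [Fintype ι] {X A : AddSubgroup V} {T : ι → RationalGroup}
    {u : ι → V} (hA : IsDecompositionBasis A T u) (hAX : A ≤ X) (hfin : A.relIndex X ≠ 0)
    (hT : Pairwise fun i j => ¬ (T i).TypeLE (T j)) {φ : V →ₗ[ℚ] V} (hφ : ∀ x ∈ X, φ x ∈ X)
    (i : ι) : ∃ t : ℚ, φ (u i) = t • u i := by
  obtain ⟨n, hn, hnA⟩ := exists_zsmul_mem_of_relIndex hfin
  obtain ⟨c, hc, hcT⟩ := hA.exists_coord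
  have hn' : (n : ℚ) ≠ 0 := by exact_mod_cast hn
  refine ⟨c (φ (u i)) i, ?_⟩
  rw [← hc _ (mem_span_of_relIndex hA hfin (hφ _ (hAX (hA.vec_mem i))))]
  refine (Finset.sum_eq_single i (fun j _ hj => ?_) (by simp)).trans ?_
  · rw [smul_eq_zero]
    refine Or.inl (by_contra fun h0 => hT hj.symm ⟨n * c (φ (u i)) j, mul_ne_zero hn' h0,
      fun x hx => ?_⟩)
    have h1 := hcT _ (hnA _ (hφ _ (hAX (hA.mulVec_le i ⟨x, hx, rfl⟩)))) j
    rw [← Int.cast_smul_eq_zsmul ℚ] at h1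
    simp only [LinearMap.toAddMonoidHom_coe, LinearMap.toSpanSingleton_apply, map_smul,
      Pi.smul_apply, smul_eq_mul] at h1
    convert h1 using 1
    ring
  · rw [hc _ (mem_span_of_relIndex hA hfin (hφ _ (hAX (hA.vec_mem i))))]

/-- Each vector of the decomposition basis lies in exactly one summand of a given direct
decomposition, and each summand contains such a vector. -/
theorem IsDirectDecomposition.exists_block [Fintype ι] [Fintype κ] {X A : AddSubgroup V}
    {T : ι → RationalGroup} {u : ι → V} (hA : IsDecompositionBasis A T u) (hAX : A ≤ X)
    (hfin : A.relIndex X ≠ 0) (hT : Pairwise fun i j => ¬ (T i).TypeLE (T j))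
    {S : κ → AddSubgroup V} (hS : IsDirectDecomposition X S) :
    ∃ b : ι → κ, Function.Surjective b ∧ ∀ i, u i ∈ S (b i) := by
  obtain ⟨P, hP1, hP0, hPS⟩ := hS.exists_projections
  have huX : ∀ i, u i ∈ X := fun i => hAX (hA.vec_mem i)
  have hsum : ∀ z ∈ X, ∑ a, P a z = z := by
    intro z hz
    rw [← hS.iSup_eq] at hz
    refine AddSubgroup.iSup_induction S (C := fun z => ∑ a, P a z = z) hz (fun a z hz => ?_)
      (by simp) (fun x y hx hy => by simp only [map_add, Finset.sum_add_distrib, hx, hy])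
    rw [Finset.sum_eq_single a (fun a' _ h => hP0 a' a h.symm z hz) (by simp), hP1 a z hz]
  have hex : ∀ i, ∃ a, u i ∈ S a := by
    intro i
    by_contra! h
    refine hA.linearIndependent.ne_zero i ?_
    rw [← hsum _ (huX i)]
    refine Finset.sum_eq_zero fun a _ => ?_
    obtain ⟨t, ht⟩ := exists_smul_eq_of_map_mem hA hAX hfin hT
      (fun x hx => hS.le a (hPS a x hx)) i
    have hidem := hP1 a _ (hPS a _ (huX i))
    rw [ht, map_smul, ht] at hidem
    by_contra h0
    -- The eigenvalue of an idempotent is `0` or `1`.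
    have ht1 : t = 1 := smul_left_injective ℚ (ht ▸ h0) (by simpa using hidem)
    refine h a ?_
    have := hPS a _ (huX i)
    rwa [ht, ht1, one_smul] at this
  choose b hb using hex
  refine ⟨b, fun a => ?_, hb⟩
  by_contra! h
  refine hS.ne_bot a ((AddSubgroup.eq_bot_iff_forall _).2 fun s hs => ?_)
  rw [← hP1 a s hs]
  exact eq_of_mem_span_range (f := P a) (g := 0) (fun i => hP0 a (b i) (h i) _ (hb i))
    (mem_span_of_relIndex hA hfin (hS.le a hs))

/-- A coordinate projection onto a union of blocks preserves the group. -/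
theorem IsDirectDecomposition.coordProj_mem [Fintype κ] {X : AddSubgroup V} {u : ι → V}
    (hX : X ≤ (Submodule.span ℚ (Set.range u)).toAddSubgroup)
    {S : κ → AddSubgroup V} (hS : IsDirectDecomposition X S) {b : ι → κ}
    (hb : ∀ i, u i ∈ S (b i)) {D : V →ₗ[ℚ] V} {E : Set ι} (hD : IsCoordProj D E u)
    (hE : ∀ i j, b i = b j → i ∈ E → j ∈ E) : ∀ x ∈ X, D x ∈ X := by
  classical
  obtain ⟨P, hP1, hP0, hPS⟩ := hS.exists_projections
  intro x hx
  have hDP : D x = (∑ a, if ∃ i ∈ E, b i = a then P a else 0) x := by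
    refine eq_of_mem_span_range (fun i => ?_) (hX hx)
    rw [LinearMap.sum_apply, Finset.sum_eq_single (b i) (fun a _ ha => ?_) (by simp)]
    · by_cases hi : i ∈ E
      · rw [if_pos ⟨i, hi, rfl⟩, (hD i).1 hi, hP1 _ _ (hb i)]
      · rw [if_neg (fun ⟨j, hj, hji⟩ => hi (hE j i hji hj)), (hD i).2 hi, LinearMap.zero_apply]
    · split_ifs
      · exact hP0 _ _ ha.symm _ (hb i)
      · rfl
  rw [hDP, LinearMap.sum_apply]
  refine sum_mem fun a _ => ?_
  split_ifs
  · exact hS.le a (hPS a x hx)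
  · exact X.zero_mem

/-- If the summands are indecomposable, a coordinate projection that preserves the group keeps or
kills each block as a whole. -/
theorem IsDirectDecomposition.mem_of_block_eq {X : AddSubgroup V} {u : ι → V}
    (hu : LinearIndependent ℚ u) (hX : X ≤ (Submodule.span ℚ (Set.range u)).toAddSubgroup)
    {S : κ → AddSubgroup V} (hS : IsDirectDecomposition X S) (hind : ∀ a, IsIndecomposable (S a))
    {b : ι → κ} (hb : ∀ i, u i ∈ S (b i)) {D : V →ₗ[ℚ] V} {E : Set ι} (hD : IsCoordProj D E u)
    (hDX : ∀ x ∈ X, D x ∈ X) {i j : ι} (hij : b i = b j) (hi : i ∈ E) : j ∈ E := by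
  obtain ⟨P, hP1, hP0, hPS⟩ := hS.exists_projections
  have hcomm : ∀ x ∈ X, P (b i) (D x) = D (P (b i) x) := fun x hx => by
    refine eq_of_mem_span_range (f := P (b i) ∘ₗ D) (g := D ∘ₗ P (b i)) (fun k => ?_) (hX hx)
    simp only [LinearMap.comp_apply]
    by_cases hk : b k = b i
    · rw [hP1 (b i) (u k) (hk ▸ hb k)]
      by_cases hkE : k ∈ E
      · rw [(hD k).1 hkE, hP1 (b i) (u k) (hk ▸ hb k)]
      · rw [(hD k).2 hkE, map_zero]
    · rw [hP0 (b i) (b k) hk (u k) (hb k)]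
      by_cases hkE : k ∈ E
      · rw [(hD k).1 hkE, hP0 (b i) (b k) hk (u k) (hb k), map_zero]
      · rw [(hD k).2 hkE, map_zero, map_zero]
  have hDS : ∀ x ∈ S (b i), D x ∈ S (b i) := fun x hx => by
    have h := hPS (b i) _ (hDX x (hS.le _ hx))
    rwa [hcomm x (hS.le _ hx), hP1 _ x hx] at h
  by_contra hj
  rcases (hind (b i)).eq_zero_or_eq_id hDS (fun x hx => hD.idem (hX (hS.le _ hx))) with h | h
  · exact hu.ne_zero i (((hD i).1 hi).symm.trans (h _ (hb i)))
  · exact hu.ne_zero j ((h _ (hij ▸ hb j)).symm.trans ((hD j).2 hj))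

/-- The case of one block. -/
theorem IsIndecomposable.mem_of_mem {X : AddSubgroup V} {u : ι → V} (hu : LinearIndependent ℚ u)
    (hX : X ≤ (Submodule.span ℚ (Set.range u)).toAddSubgroup) (hind : IsIndecomposable X)
    (huX : ∀ i, u i ∈ X) {D : V →ₗ[ℚ] V} {E : Set ι} (hD : IsCoordProj D E u)
    (hDX : ∀ x ∈ X, D x ∈ X) {i j : ι} (hi : i ∈ E) : j ∈ E := by
  by_contra hj
  rcases hind.eq_zero_or_eq_id hDX (fun x hx => hD.idem (hX hx)) with h | h
  · exact hu.ne_zero i (((hD i).1 hi).symm.trans (h _ (huX i)))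
  · exact hu.ne_zero j ((h _ (huX j)).symm.trans ((hD j).2 hj))

/-- A group is indecomposable if the basis vectors cannot be separated by a coordinate projection
preserving it. -/
theorem isIndecomposable_of_forall [Fintype ι] {X A : AddSubgroup V} {T : ι → RationalGroup}
    {u : ι → V} (hA : IsDecompositionBasis A T u) (hAX : A ≤ X) (hfin : A.relIndex X ≠ 0)
    (hT : Pairwise fun i j => ¬ (T i).TypeLE (T j)) (hX : X ≠ ⊥)
    (h : ∀ E : Set ι, (∀ D, IsCoordProj D E u → ∀ x ∈ X, D x ∈ X) → ∀ i j, i ∈ E → j ∈ E) :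
    IsIndecomposable X := by
  refine ⟨hX, fun B C hinf hsup => ?_⟩
  by_contra! hBC
  have hS : IsDirectDecomposition X (fun a : Bool => cond a B C) := by
    refine ⟨Bool.forall_bool.2 ⟨hBC.2, hBC.1⟩, ?_, by rw [iSup_bool_eq]; exact hsup⟩
    rw [iSupIndep_pair (i := true) (j := false) (by decide) (by decide)]
    exact disjoint_iff.2 hinf
  obtain ⟨b, hsurj, hb⟩ := hS.exists_block hA hAX hfin hT
  obtain ⟨i, hi⟩ := hsurj true
  obtain ⟨j, hj⟩ := hsurj false
  have hj' : b j = true := h {i | b i = true} (fun D hD =>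
    hS.coordProj_mem (fun x hx => mem_span_of_relIndex hA hfin hx) hb hD
      (fun i j hij (hi : b i = true) => (hij ▸ hi : b j = true))) i j hi
  rw [hj] at hj'
  exact Bool.false_ne_true hj'

/-- A coordinate projection that preserves a direct sum `G ⊔ H` preserves the summand `G` spanned by
the vectors in question. -/
theorem IsCoordProj.map_mem_left {G H : AddSubgroup V} {u : ι → V}
    (hG : G ≤ (Submodule.span ℚ (Set.range u)).toAddSubgroup) (huG : ∀ i, u i ∈ G)
    (hinf : G ⊓ H = ⊥) {D : V →ₗ[ℚ] V} {E : Set ι} (hD : IsCoordProj D E u)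
    (h : ∀ z ∈ G ⊔ H, D z ∈ G ⊔ H) : ∀ z ∈ G, D z ∈ G := by
  obtain ⟨P, hP1, hP0⟩ := exists_projection_of_inf_eq_bot hinf
  intro z hz
  obtain ⟨a, ha, b, hb, hab⟩ := AddSubgroup.mem_sup.1 (h z ((le_sup_left : G ≤ G ⊔ H) hz))
  have hP : P (D z) = D z := eq_of_mem_span_range (u := u) (f := P) (g := LinearMap.id)
    (fun i => hP1 _ (huG i)) (hD.map_mem_span (hG hz))
  rw [← hP, ← hab, map_add, hP1 a ha, hP0 b hb, add_zero]
  exact ha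

end Blocks

/-! ### Unimodular change of the decomposition basis -/

section BasisChange

variable {V : Type*} [AddCommGroup V] {ι δ : Type*}

theorem exists_unimodular {m : ℤ} (hm : m ≠ 0) (n : ℤ) : ∃ a b c g : ℤ,
    m = (Int.gcd m n : ℤ) * a ∧ n = (Int.gcd m n : ℤ) * b ∧ a * g + b * c = 1 := by
  obtain ⟨a, ha⟩ := Int.gcd_dvd_left m n
  obtain ⟨b, hb⟩ := Int.gcd_dvd_right m n
  have h0 : (Int.gcd m n : ℤ) ≠ 0 := fun h => hm (by rw [ha, h, zero_mul])
  refine ⟨a, b, Int.gcdB m n, Int.gcdA m n, ha, hb, mul_left_cancel₀ h0 ?_⟩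
  have h := Int.gcd_eq_gcd_ab m n
  calc (Int.gcd m n : ℤ) * (a * Int.gcdA m n + b * Int.gcdB m n)
      = (Int.gcd m n * a) * Int.gcdA m n + (Int.gcd m n * b) * Int.gcdB m n := by ring
    _ = Int.gcd m n * 1 := by rw [← ha, ← hb, ← h, mul_one]

/-- Two elements of coprime orders modulo `A` generate the same group modulo `A` as their sum. -/
theorem sup_zmultiples_add {A : AddSubgroup V} {g₁ g₂ : V} {e₁ e₂ : ℤ} (h : IsCoprime e₁ e₂)
    (h₁ : e₁ • g₁ ∈ A) (h₂ : e₂ • g₂ ∈ A) :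
    A ⊔ AddSubgroup.zmultiples (g₁ + g₂) =
      (A ⊔ AddSubgroup.zmultiples g₁) ⊔ AddSubgroup.zmultiples g₂ := by
  have key : ∀ (g₁ g₂ : V) (e₁ e₂ : ℤ), IsCoprime e₁ e₂ → e₁ • g₁ ∈ A → e₂ • g₂ ∈ A →
      g₁ ∈ A ⊔ AddSubgroup.zmultiples (g₁ + g₂) := by
    rintro g₁ g₂ e₁ e₂ ⟨r, s, hrs⟩ h₁ h₂
    refine AddSubgroup.mem_sup.2 ⟨r • e₁ • g₁ - s • e₂ • g₂,
      sub_mem (A.zsmul_mem h₁ r) (A.zsmul_mem h₂ s), (s * e₂) • (g₁ + g₂), ⟨s * e₂, rfl⟩, ?_⟩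
    calc r • e₁ • g₁ - s • e₂ • g₂ + (s * e₂) • (g₁ + g₂) = (r * e₁ + s * e₂) • g₁ := by module
      _ = g₁ := by rw [hrs, one_smul]
  refine le_antisymm (sup_le (le_sup_left.trans le_sup_left) ?_)
    (sup_le (sup_le le_sup_left ?_) ?_) <;> rw [AddSubgroup.zmultiples_le]
  · exact add_mem
      (AddSubgroup.mem_sup_left (AddSubgroup.mem_sup_right (AddSubgroup.mem_zmultiples g₁)))
      (AddSubgroup.mem_sup_right (AddSubgroup.mem_zmultiples g₂))
  · exact key g₁ g₂ e₁ e₂ h h₁ h₂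
  · rw [add_comm]
    exact key g₂ g₁ e₂ e₁ h.symm h₂ h₁

variable [Module ℚ V]

theorem LinearIndependent.unimodular_change {v w : δ → V} {z : ι → V}
    (hu : LinearIndependent ℚ (Sum.elim (Sum.elim v w) z)) {a b c g : δ → ℤ}
    (h : ∀ i, a i * g i + b i * c i = 1) :
    LinearIndependent ℚ (Sum.elim (Sum.elim
      (fun i => (a i : ℚ) • v i + (b i : ℚ) • w i)
      (fun i => ((-c i : ℤ) : ℚ) • v i + (g i : ℚ) • w i)) z) := by
  -- The inverse substitution sends the new family back to the old one.
  obtain ⟨N, hN⟩ := hu.exists_linearMap (Sum.elim (Sum.elim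
    (fun i => (g i : ℚ) • v i - (b i : ℚ) • w i) (fun i => (c i : ℚ) • v i + (a i : ℚ) • w i)) z)
  have hv : ∀ i, N (v i) = (g i : ℚ) • v i - (b i : ℚ) • w i := fun i => hN (Sum.inl (Sum.inl i))
  have hw : ∀ i, N (w i) = (c i : ℚ) • v i + (a i : ℚ) • w i := fun i => hN (Sum.inl (Sum.inr i))
  have hz : ∀ i, N (z i) = z i := fun i => hN (Sum.inr i)
  have h' : ∀ i, (a i : ℚ) * g i + b i * c i = 1 := fun i => by exact_mod_cast h i
  refine LinearIndependent.of_comp N ?_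
  convert hu using 1
  funext k
  rcases k with (i | i) | i
  · simp only [Function.comp_apply, Sum.elim_inl, map_add, map_smul, hv, hw]
    calc (a i : ℚ) • ((g i : ℚ) • v i - (b i : ℚ) • w i)
          + (b i : ℚ) • ((c i : ℚ) • v i + (a i : ℚ) • w i)
        = ((a i : ℚ) * g i + b i * c i) • v i := by module
      _ = v i := by rw [h', one_smul]
  · simp only [Function.comp_apply, Sum.elim_inl, Sum.elim_inr, map_add, map_smul, hv, hw]
    push_cast
    calc (-(c i : ℚ)) • ((g i : ℚ) • v i - (b i : ℚ) • w i)
          + (g i : ℚ) • ((c i : ℚ) • v i + (a i : ℚ) • w i)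
        = ((a i : ℚ) * g i + b i * c i) • w i := by module
      _ = w i := by rw [h', one_smul]
  · simp [hz]

theorem RationalGroup.mulVec_sup_mulVec_unimodular (τ : RationalGroup) (v w : V) {a b c g : ℤ}
    (h : a * g + b * c = 1) :
    τ.mulVec ((a : ℚ) • v + (b : ℚ) • w) ⊔ τ.mulVec (((-c : ℤ) : ℚ) • v + (g : ℚ) • w) =
      τ.mulVec v ⊔ τ.mulVec w := by
  have h' : (a : ℚ) * g + b * c = 1 := by exact_mod_cast h
  refine le_antisymm (sup_le (τ.mulVec_add_le _ _ _ _) (τ.mulVec_add_le _ _ _ _)) ?_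
  set v' := (a : ℚ) • v + (b : ℚ) • w with hv'
  set w' := ((-c : ℤ) : ℚ) • v + (g : ℚ) • w with hw'
  have hv : v = (g : ℚ) • v' + ((-b : ℤ) : ℚ) • w' := by
    rw [hv', hw']
    push_cast
    calc v = ((a : ℚ) * g + b * c) • v := by rw [h', one_smul]
      _ = _ := by module
  have hw : w = (c : ℚ) • v' + (a : ℚ) • w' := by
    rw [hv', hw']
    push_cast
    calc w = ((a : ℚ) * g + b * c) • w := by rw [h', one_smul]
      _ = _ := by module
  refine sup_le ?_ ?_
  · conv_lhs => rw [hv]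
    exact τ.mulVec_add_le _ _ _ _
  · conv_lhs => rw [hw]
    exact τ.mulVec_add_le _ _ _ _

theorem IsDecompositionBasis.unimodular_change {A : AddSubgroup V} {τ : δ → RationalGroup}
    {T : ι → RationalGroup} {v w : δ → V} {z : ι → V}
    (hA : IsDecompositionBasis A (Sum.elim (Sum.elim τ τ) T) (Sum.elim (Sum.elim v w) z))
    {a b c g : δ → ℤ} (h : ∀ i, a i * g i + b i * c i = 1) :
    IsDecompositionBasis A (Sum.elim (Sum.elim τ τ) T) (Sum.elim (Sum.elim
      (fun i => (a i : ℚ) • v i + (b i : ℚ) • w i)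
      (fun i => ((-c i : ℤ) : ℚ) • v i + (g i : ℚ) • w i)) z) := by
  refine ⟨hA.linearIndependent.unimodular_change h, ?_⟩
  rw [hA.eq_iSup]
  simp only [iSup_sum, Sum.elim_inl, Sum.elim_inr, ← iSup_sup_eq]
  congr 1
  exact iSup_congr fun i => ((τ i).mulVec_sup_mulVec_unimodular _ _ (h i)).symm

/-- The basis of a sum of two completely decomposable groups, with the vectors of both
`δ`-indexed parts listed first. -/
theorem IsDecompositionBasis.sup_sum {π π' : Type*} {A₁ A₂ : AddSubgroup V}
    {τ τ' : δ → RationalGroup} {σ : π → RationalGroup} {ρ : π' → RationalGroup} {v w : δ → V}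
    {x : π → V} {y : π' → V} (h₁ : IsDecompositionBasis A₁ (Sum.elim τ σ) (Sum.elim v x))
    (h₂ : IsDecompositionBasis A₂ (Sum.elim τ' ρ) (Sum.elim w y)) (hinf : A₁ ⊓ A₂ = ⊥) :
    IsDecompositionBasis (A₁ ⊔ A₂) (Sum.elim (Sum.elim τ τ') (Sum.elim σ ρ))
      (Sum.elim (Sum.elim v w) (Sum.elim x y)) := by
  constructor
  · have hli := (h₁.sup h₂ hinf).linearIndependent
    rw [← linearIndependent_equiv (Equiv.sumSumSumComm δ δ π π')] at hli
    have hcomp : Sum.elim (Sum.elim v x) (Sum.elim w y) ∘ Equiv.sumSumSumComm δ δ π π' =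
        Sum.elim (Sum.elim v w) (Sum.elim x y) := by
      funext k
      rcases k with (i | i) | (i | i) <;> rfl
    rwa [hcomp] at hli
  · rw [(h₁.sup h₂ hinf).eq_iSup]
    simp only [iSup_sum, Sum.elim_inl, Sum.elim_inr]
    ac_rfl

theorem cyclicExtension_generator_mem {A : AddSubgroup V} [Fintype ι] {T : ι → RationalGroup}
    {u : ι → V} (hA : IsDecompositionBasis A T u) {e : ℤ} (he : e ≠ 0) (α : ι → ℤ) :
    e • ((e : ℚ)⁻¹ • ∑ i, α i • u i) ∈ A := by
  rw [← Int.cast_smul_eq_zsmul ℚ, smul_inv_smul₀ (by exact_mod_cast he)]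
  exact sum_mem fun i _ => A.zsmul_mem (hA.vec_mem i) _

end BasisChange

/-! ### Summands of the merged group -/

section Merged

variable {V : Type*} [AddCommGroup V] [Module ℚ V] {δ π π' : Type*}

/-- The first group has index set `δ ⊕ π`, the second one `δ ⊕ π'`, the merged one `δ ⊕ (π ⊕ π')`.
A set `E` of indices of the merged group gives a coordinate projection for all three families at
once, since each `v' i` lies in the span of `v i` and `w i`. -/
theorem exists_isCoordProj {v w v' w' : δ → V} {x : π → V} {y : π' → V}
    (hu : LinearIndependent ℚ (Sum.elim (Sum.elim v w) (Sum.elim x y)))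
    (hv' : ∀ i, ∃ a b : ℚ, v' i = a • v i + b • w i)
    (hw' : ∀ i, ∃ a b : ℚ, w' i = a • v i + b • w i) (E : Set (δ ⊕ (π ⊕ π'))) :
    ∃ D : V →ₗ[ℚ] V, IsCoordProj D (Sum.map id Sum.inl ⁻¹' E) (Sum.elim v x) ∧
      IsCoordProj D (Sum.map id Sum.inr ⁻¹' E) (Sum.elim w y) ∧
      IsCoordProj D E (Sum.elim v' (Sum.elim x y)) ∧
      ∀ i, D (w' i) = w' i ∨ D (w' i) = 0 := by
  classical
  obtain ⟨D, hD⟩ := hu.exists_linearMap (Sum.elim (Sum.elim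
    (fun i => if Sum.inl i ∈ E then v i else 0) (fun i => if Sum.inl i ∈ E then w i else 0))
    (Sum.elim (fun i => if Sum.inr (Sum.inl i) ∈ E then x i else 0)
      (fun i => if Sum.inr (Sum.inr i) ∈ E then y i else 0)))
  have hv : ∀ i, D (v i) = if Sum.inl i ∈ E then v i else 0 := fun i => hD (Sum.inl (Sum.inl i))
  have hw : ∀ i, D (w i) = if Sum.inl i ∈ E then w i else 0 := fun i => hD (Sum.inl (Sum.inr i))
  have hx : ∀ i, D (x i) = if Sum.inr (Sum.inl i) ∈ E then x i else 0 :=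
    fun i => hD (Sum.inr (Sum.inl i))
  have hy : ∀ i, D (y i) = if Sum.inr (Sum.inr i) ∈ E then y i else 0 :=
    fun i => hD (Sum.inr (Sum.inr i))
  have hvw : ∀ (i : δ) (z : V), (∃ a b : ℚ, z = a • v i + b • w i) →
      D z = if Sum.inl i ∈ E then z else 0 := by
    rintro i z ⟨a, b, rfl⟩
    rw [map_add, map_smul, map_smul, hv, hw]
    split_ifs <;> simp
  refine ⟨D, ?_, ?_, ?_, fun i => ?_⟩
  · rintro (i | i)
    · exact ⟨fun h => (hv i).trans (if_pos h), fun h => (hv i).trans (if_neg h)⟩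
    · exact ⟨fun h => (hx i).trans (if_pos h), fun h => (hx i).trans (if_neg h)⟩
  · rintro (i | i)
    · exact ⟨fun h => (hw i).trans (if_pos h), fun h => (hw i).trans (if_neg h)⟩
    · exact ⟨fun h => (hy i).trans (if_pos h), fun h => (hy i).trans (if_neg h)⟩
  · rintro (i | i | i)
    · exact ⟨fun h => by rw [Sum.elim_inl, hvw i _ (hv' i), if_pos h],
        fun h => by rw [Sum.elim_inl, hvw i _ (hv' i), if_neg h]⟩
    · exact ⟨fun h => by simp [hx, h], fun h => by simp [hx, h]⟩
    · exact ⟨fun h => by simp [hy, h], fun h => by simp [hy, h]⟩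
  · rw [hvw i _ (hw' i)]
    split_ifs
    · exact Or.inl rfl
    · exact Or.inr rfl

theorem map_mem_sup {G H : AddSubgroup V} {D : V →ₗ[ℚ] V} (hG : ∀ z ∈ G, D z ∈ G)
    (hH : ∀ z ∈ H, D z ∈ H) : ∀ z ∈ G ⊔ H, D z ∈ G ⊔ H := by
  intro z hz
  obtain ⟨a, ha, b, hb, rfl⟩ := AddSubgroup.mem_sup.1 hz
  rw [map_add]
  exact AddSubgroup.mem_sup.2 ⟨_, hG a ha, _, hH b hb, rfl⟩

/-- If `X₁ ⊕ X₂ = Y ⊕ W`, where `W` is generated by rank-one groups on eigenvectors of the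
coordinate projection `D` with eigenvalues `0` and `1`, then `D` preserves `Y` if and only if it
preserves both `X₁` and `X₂`. -/
theorem map_mem_iff {ι₁ ι₂ ι₃ : Type*} {X₁ X₂ Y : AddSubgroup V} {u₁ : ι₁ → V} {u₂ : ι₂ → V}
    {u₃ : ι₃ → V} {τ : δ → RationalGroup} {w' : δ → V}
    (h₁ : X₁ ≤ (Submodule.span ℚ (Set.range u₁)).toAddSubgroup) (hu₁ : ∀ i, u₁ i ∈ X₁)
    (h₂ : X₂ ≤ (Submodule.span ℚ (Set.range u₂)).toAddSubgroup) (hu₂ : ∀ i, u₂ i ∈ X₂)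
    (h₃ : Y ≤ (Submodule.span ℚ (Set.range u₃)).toAddSubgroup) (hu₃ : ∀ i, u₃ i ∈ Y)
    (hinf : X₁ ⊓ X₂ = ⊥) (hinf' : Y ⊓ (⨆ i, (τ i).mulVec (w' i)) = ⊥)
    (hsup : X₁ ⊔ X₂ = Y ⊔ ⨆ i, (τ i).mulVec (w' i))
    {D : V →ₗ[ℚ] V} {E₁ : Set ι₁} {E₂ : Set ι₂} {E₃ : Set ι₃} (hD₁ : IsCoordProj D E₁ u₁)
    (hD₂ : IsCoordProj D E₂ u₂) (hD₃ : IsCoordProj D E₃ u₃)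
    (hw : ∀ i, D (w' i) = w' i ∨ D (w' i) = 0) :
    (∀ z ∈ Y, D z ∈ Y) ↔ (∀ z ∈ X₁, D z ∈ X₁) ∧ ∀ z ∈ X₂, D z ∈ X₂ := by
  constructor
  · intro h
    have hW : ∀ z ∈ ⨆ i, (τ i).mulVec (w' i), D z ∈ ⨆ i, (τ i).mulVec (w' i) := by
      have hle : (⨆ i, (τ i).mulVec (w' i)) ≤
          (⨆ i, (τ i).mulVec (w' i)).comap D.toAddMonoidHom := by
        refine iSup_le ?_
        rintro i _ ⟨c, hc, rfl⟩
        change D (c • w' i) ∈ ⨆ i, (τ i).mulVec (w' i)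
        rw [map_smul]
        rcases hw i with h | h <;> rw [h]
        · exact AddSubgroup.mem_iSup_of_mem i ⟨c, hc, rfl⟩
        · rw [smul_zero]
          exact AddSubgroup.zero_mem _
      exact hle
    have hX := map_mem_sup h hW
    rw [← hsup] at hX
    refine ⟨hD₁.map_mem_left h₁ hu₁ hinf hX, ?_⟩
    rw [sup_comm] at hX
    exact hD₂.map_mem_left h₂ hu₂ (inf_comm X₁ X₂ ▸ hinf) hX
  · rintro ⟨h, h'⟩
    have hX := map_mem_sup h h'
    rw [hsup] at hX
    exact hD₃.map_mem_left h₃ hu₃ hinf' hX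

/-- Partitions of `δ ⊕ π` and `δ ⊕ π'` into `n₁` and `n₂` blocks, and a partition of `δ ⊕ (π ⊕ π')`
into `m` blocks. If every set that induces unions of blocks on `δ ⊕ π` and `δ ⊕ π'` is a union of
blocks itself, then `n₁ + n₂ ≤ m + |δ|`: pairs of functions on the blocks of the first two
partitions embed linearly into functions on the blocks of the third, once they agree on `δ`, which
imposes `|δ|` linear conditions. -/
theorem card_blocks_le [Fintype δ] {κ₁ κ₂ κ : Type*} [Fintype κ₁] [Fintype κ₂] [Fintype κ]
    {b₁ : δ ⊕ π → κ₁} {b₂ : δ ⊕ π' → κ₂} {b : δ ⊕ (π ⊕ π') → κ}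
    (hb₁ : Function.Surjective b₁) (hb₂ : Function.Surjective b₂) (hb : Function.Surjective b)
    (h : ∀ E : Set (δ ⊕ (π ⊕ π')),
      (∀ i j, b₁ i = b₁ j → Sum.map id Sum.inl i ∈ E → Sum.map id Sum.inl j ∈ E) →
      (∀ i j, b₂ i = b₂ j → Sum.map id Sum.inr i ∈ E → Sum.map id Sum.inr j ∈ E) →
      ∀ i j, b i = b j → i ∈ E → j ∈ E) :
    Fintype.card κ₁ + Fintype.card κ₂ ≤ Fintype.card κ + Fintype.card δ := by
  choose r hr using hb
  let F : (κ₁ → ℚ) × (κ₂ → ℚ) →ₗ[ℚ] (δ ⊕ (π ⊕ π') → ℚ) :=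
    { toFun := fun f => Sum.elim (fun i => f.1 (b₁ (Sum.inl i)))
        (Sum.elim (fun i => f.1 (b₁ (Sum.inr i))) (fun i => f.2 (b₂ (Sum.inr i))))
      map_add' := fun f g => by ext (i | i | i) <;> rfl
      map_smul' := fun c f => by ext (i | i | i) <;> rfl }
  let G : (κ₁ → ℚ) × (κ₂ → ℚ) →ₗ[ℚ] (κ → ℚ) × (δ → ℚ) :=
    { toFun := fun f => (fun k => F f (r k),
        fun i => f.1 (b₁ (Sum.inl i)) - f.2 (b₂ (Sum.inl i)))
      map_add' := fun f g => by
        refine Prod.ext (funext fun i => ?_) (funext fun i => ?_) <;> simp; ring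
      map_smul' := fun c f => by
        refine Prod.ext (funext fun i => ?_) (funext fun i => ?_) <;> simp; ring }
  have hinj : Function.Injective G := by
    rw [injective_iff_map_eq_zero]
    intro f hf
    have hfr : ∀ k, F f (r k) = 0 := fun k => congrFun (congrArg Prod.fst hf) k
    have hfd : ∀ i, f.1 (b₁ (Sum.inl i)) = f.2 (b₂ (Sum.inl i)) := fun i =>
      sub_eq_zero.1 (congrFun (congrArg Prod.snd hf) i)
    have hF₁ : ∀ i, F f (Sum.map id Sum.inl i) = f.1 (b₁ i) := by rintro (i | i) <;> rfl
    have hF₂ : ∀ i, F f (Sum.map id Sum.inr i) = f.2 (b₂ i) := by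
      rintro (i | i)
      · exact hfd i
      · rfl
    have hF : ∀ j, F f j = 0 := fun j => by
      have := h {i | F f i = F f (r (b j))}
        (fun i j hij hi => by rw [Set.mem_ofPred_eq, hF₁] at hi ⊢; rw [← hij, hi])
        (fun i j hij hi => by rw [Set.mem_ofPred_eq, hF₂] at hi ⊢; rw [← hij, hi])
        (r (b j)) j (hr _) rfl
      rw [Set.mem_ofPred_eq] at this
      rw [this, hfr]
    refine Prod.ext (funext fun k => ?_) (funext fun k => ?_)
    · obtain ⟨i, rfl⟩ := hb₁ k
      rw [← hF₁, hF]; rfl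
    · obtain ⟨i, rfl⟩ := hb₂ k
      rw [← hF₂, hF]; rfl
  have := LinearMap.finrank_le_finrank_of_injective hinj
  simpa using this

end Merged

/-! ### The merged group -/

theorem mainTheorem6 {V : Type*} [AddCommGroup V] [Module ℚ V]
    {d p q : ℕ} (hd : 1 ≤ d)
    (τ : Fin d → RationalGroup) (σ : Fin p → RationalGroup) (ρ : Fin q → RationalGroup)
    (hincomparable : Pairwise fun i j : Fin d ⊕ (Fin p ⊕ Fin q) =>
      ¬ (Sum.elim τ (Sum.elim σ ρ) i).TypeLE (Sum.elim τ (Sum.elim σ ρ) j))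
    (v w : Fin d → V) (x : Fin p → V) (y : Fin q → V)
    (A₁ A₂ X₁ X₂ : AddSubgroup V)
    (hA₁ : IsDecompositionBasis A₁ (Sum.elim τ σ) (Sum.elim v x))
    (hA₂ : IsDecompositionBasis A₂ (Sum.elim τ ρ) (Sum.elim w y))
    (e₁ e₂ : ℤ) (he₁ : e₁ ≠ 0) (he₂ : e₂ ≠ 0) (hcoprime : IsCoprime e₁ e₂)
    (α : Fin d ⊕ Fin p → ℤ) (β : Fin d ⊕ Fin q → ℤ)
    (hα : ∀ i, α i ∣ e₁) (hβ : ∀ j, β j ∣ e₂)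
    (hX₁ : X₁ = cyclicExtension A₁ e₁ α (Sum.elim v x))
    (hX₂ : X₂ = cyclicExtension A₂ e₂ β (Sum.elim w y))
    (hR₁ : A₁ = regulator X₁) (hR₂ : A₂ = regulator X₂)
    (hdirect : X₁ ⊓ X₂ = ⊥) :
    A₁ ⊔ A₂ = regulator (X₁ ⊔ X₂) ∧
    ∃ (v' w' : Fin d → V) (A Y : AddSubgroup V),
      IsDecompositionBasis (A₁ ⊔ A₂) (Sum.elim (Sum.elim τ τ) (Sum.elim σ ρ))
        (Sum.elim (Sum.elim v' w') (Sum.elim x y)) ∧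
      IsDecompositionBasis A (Sum.elim τ (Sum.elim σ ρ)) (Sum.elim v' (Sum.elim x y)) ∧
      Y = cyclicExtension A (e₁ * e₂) (mergedCoeff e₁ e₂ α β)
        (Sum.elim v' (Sum.elim x y)) ∧
      IsDirectDecomposition (X₁ ⊔ X₂)
        (fun k : Option (Fin d) => k.elim Y (fun i => (τ i).mulVec (w' i))) ∧
      (IsIndecomposable X₁ → IsIndecomposable X₂ → IsIndecomposable Y) ∧
      (∀ k, mergedCoeff e₁ e₂ α β k ∣ e₁ * e₂) ∧
      Fintype.card (Fin 2) ≤ Fintype.card (Option (Fin d)) ∧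
      (∀ (n₁ n₂ m : ℕ) (S₁ : Fin n₁ → AddSubgroup V) (S₂ : Fin n₂ → AddSubgroup V)
        (T : Fin m → AddSubgroup V),
        IsDirectDecomposition X₁ S₁ → (∀ i, IsIndecomposable (S₁ i)) →
        IsDirectDecomposition X₂ S₂ → (∀ i, IsIndecomposable (S₂ i)) →
        IsDirectDecomposition Y T → (∀ i, IsIndecomposable (T i)) →
        n₁ + n₂ ≤ m + d) := by
  set T : Fin d ⊕ (Fin p ⊕ Fin q) → RationalGroup := Sum.elim τ (Sum.elim σ ρ) with hTdef
  set g₁ : V := (e₁ : ℚ)⁻¹ • ∑ i, α i • Sum.elim v x i with hg₁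
  set g₂ : V := (e₂ : ℚ)⁻¹ • ∑ i, β i • Sum.elim w y i with hg₂
  have hg₁A : e₁ • g₁ ∈ A₁ := cyclicExtension_generator_mem hA₁ he₁ α
  have hg₂A : e₂ • g₂ ∈ A₂ := cyclicExtension_generator_mem hA₂ he₂ β
  replace hX₁ : X₁ = A₁ ⊔ AddSubgroup.zmultiples g₁ := hX₁
  replace hX₂ : X₂ = A₂ ⊔ AddSubgroup.zmultiples g₂ := hX₂
  have hle₁ : A₁ ≤ X₁ := hX₁ ▸ le_sup_left
  have hle₂ : A₂ ≤ X₂ := hX₂ ▸ le_sup_left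
  have hfin₁ : A₁.relIndex X₁ ≠ 0 := hX₁ ▸ relIndex_sup_zmultiples_ne_zero he₁ hg₁A
  have hfin₂ : A₂.relIndex X₂ ≠ 0 := hX₂ ▸ relIndex_sup_zmultiples_ne_zero he₂ hg₂A
  have hinfA : A₁ ⊓ A₂ = ⊥ := le_bot_iff.1 (hdirect ▸ inf_le_inf hle₁ hle₂)
  have hsupX : X₁ ⊔ X₂ = (A₁ ⊔ A₂) ⊔ AddSubgroup.zmultiples (g₁ + g₂) := by
    rw [sup_zmultiples_add hcoprime (AddSubgroup.mem_sup_left hg₁A)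
      (AddSubgroup.mem_sup_right hg₂A), hX₁, hX₂]
    ac_rfl
  have hg : (e₁ * e₂) • (g₁ + g₂) ∈ A₁ ⊔ A₂ := by
    have : (e₁ * e₂) • (g₁ + g₂) = e₂ • e₁ • g₁ + e₁ • e₂ • g₂ := by module
    rw [this]
    exact add_mem (AddSubgroup.mem_sup_left (A₁.zsmul_mem hg₁A _))
      (AddSubgroup.mem_sup_right (A₂.zsmul_mem hg₂A _))
  have he : e₁ * e₂ ≠ 0 := mul_ne_zero he₁ he₂
  have hfin : (A₁ ⊔ A₂).relIndex (X₁ ⊔ X₂) ≠ 0 :=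
    hsupX ▸ relIndex_sup_zmultiples_ne_zero he hg
  have hinj₁ : Function.Injective (Sum.map id Sum.inl : Fin d ⊕ Fin p → Fin d ⊕ (Fin p ⊕ Fin q)) :=
    Function.injective_id.sumMap Sum.inl_injective
  have hinj₂ : Function.Injective (Sum.map id Sum.inr : Fin d ⊕ Fin q → Fin d ⊕ (Fin p ⊕ Fin q)) :=
    Function.injective_id.sumMap Sum.inr_injective
  have hT₁ : ∀ i, Sum.elim τ σ i = T (Sum.map id Sum.inl i) := by rintro (i | i) <;> rfl
  have hT₂ : ∀ i, Sum.elim τ ρ i = T (Sum.map id Sum.inr i) := by rintro (i | i) <;> rfl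
  have hinc₁ : Pairwise fun i j => ¬ (Sum.elim τ σ i).TypeLE (Sum.elim τ σ j) :=
    fun i j hij h => hincomparable (hinj₁.ne hij) (by rwa [hT₁ i, hT₁ j] at h)
  have hinc₂ : Pairwise fun i j => ¬ (Sum.elim τ ρ i).TypeLE (Sum.elim τ ρ j) :=
    fun i j hij h => hincomparable (hinj₂.ne hij) (by rwa [hT₂ i, hT₂ j] at h)
  refine ⟨regulator_sup_eq hA₁ hA₂ hle₁ hle₂ hfin₁ hfin₂ hfin hR₁ hR₂ hdirect hinj₁ hinj₂ ?_, ?_⟩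
  · intro i j hij
    by_contra hne
    refine hincomparable hne ?_
    rcases i with i | i <;> rcases j with j | j <;>
      simpa only [Sum.elim_inl, Sum.elim_inr, hT₁, hT₂] using hij
  have hA := hA₁.sup_sum hA₂ hinfA
  have hα0 : ∀ i, e₂ * α (Sum.inl i) ≠ 0 := fun i =>
    mul_ne_zero he₂ fun h => he₁ (zero_dvd_iff.1 (h ▸ hα (Sum.inl i)))
  choose a b c g hma hnb hdet using
    fun i : Fin d => exists_unimodular (hα0 i) (e₁ * β (Sum.inl i))
  have hA' := hA.unimodular_change hdet
  set v' : Fin d → V := fun i => (a i : ℚ) • v i + (b i : ℚ) • w i with hv'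
  set w' : Fin d → V := fun i => ((-c i : ℤ) : ℚ) • v i + (g i : ℚ) • w i with hw'
  set u : Fin d ⊕ (Fin p ⊕ Fin q) → V := Sum.elim v' (Sum.elim x y) with hu
  set B : AddSubgroup V := ⨆ k, (T k).mulVec (u k) with hB
  set W : AddSubgroup V := ⨆ i, (τ i).mulVec (w' i) with hW
  have hBu : IsDecompositionBasis B T u := by
    refine ⟨?_, rfl⟩
    have := hA'.linearIndependent.comp (Sum.map Sum.inl id)
      (Sum.inl_injective.sumMap Function.injective_id)
    have hcomp : Sum.elim (Sum.elim v' w') (Sum.elim x y) ∘ Sum.map Sum.inl id = u := by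
      funext k
      rcases k with i | i <;> rfl
    rwa [hcomp] at this
  have hBW : A₁ ⊔ A₂ = B ⊔ W := by
    rw [hA'.eq_iSup]
    simp only [hB, hW, hTdef, hu, iSup_sum, Sum.elim_inl, Sum.elim_inr]
    exact sup_right_comm _ _ _
  -- Since `f i • v' i = (e₂ * α i) • v i + (e₁ * β i) • w i`, the generator of the merged group
  -- is the sum of the two given generators.
  have hgen : ((e₁ * e₂ : ℤ) : ℚ)⁻¹ • ∑ k, mergedCoeff e₁ e₂ α β k • u k = g₁ + g₂ := by
    have hsum : ∑ k, mergedCoeff e₁ e₂ α β k • u k = (e₂ : ℚ) • ∑ i, α i • Sum.elim v x i +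
        (e₁ : ℚ) • ∑ i, β i • Sum.elim w y i := by
      have hfv : ∀ i, (Int.gcd (e₂ * α (Sum.inl i)) (e₁ * β (Sum.inl i)) : ℤ) • v' i =
          (e₂ * α (Sum.inl i)) • v i + (e₁ * β (Sum.inl i)) • w i := fun i => by
        rw [hv', smul_add, Int.cast_smul_eq_zsmul, Int.cast_smul_eq_zsmul, smul_smul, smul_smul]
        exact (congrArg₂ (fun m n : ℤ => m • v i + n • w i) (hma i) (hnb i)).symm
      simp only [Fintype.sum_sum_type, mergedCoeff, hu, Sum.elim_inl, Sum.elim_inr, hfv,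
        Finset.sum_add_distrib, Int.cast_smul_eq_zsmul, smul_add, Finset.smul_sum, mul_smul]
      abel
    rw [hsum, smul_add, smul_smul, smul_smul, hg₁, hg₂]
    congr 2
    · rw [Int.cast_mul, mul_inv, inv_mul_cancel_right₀ (by exact_mod_cast he₂)]
    · rw [Int.cast_mul, mul_comm, mul_inv, mul_inv_cancel_left₀ (by exact_mod_cast he₁)]
  set Y : AddSubgroup V := cyclicExtension B (e₁ * e₂) (mergedCoeff e₁ e₂ α β) u with hY
  have hY' : Y = B ⊔ AddSubgroup.zmultiples (g₁ + g₂) := by rw [hY, cyclicExtension, hgen]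
  have hBY : B ≤ Y := hY' ▸ le_sup_left
  have hfinY : B.relIndex Y ≠ 0 := relIndex_sup_zmultiples_ne_zero he
    (cyclicExtension_generator_mem hBu he (mergedCoeff e₁ e₂ α β))
  have hXYW : X₁ ⊔ X₂ = Y ⊔ W := by
    rw [hsupX, hBW, hY']
    ac_rfl
  have huY : ∀ k, u k ∈ Y := fun k => hBY (hBu.vec_mem k)
  have hYspan : Y ≤ (Submodule.span ℚ (Set.range u)).toAddSubgroup := fun z hz =>
    mem_span_of_relIndex hBu hfinY hz
  have hdec : IsDirectDecomposition (X₁ ⊔ X₂)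
      (fun k : Option (Fin d) => k.elim Y (fun i => (τ i).mulVec (w' i))) := by
    refine ⟨?_, ?_, ?_⟩
    · rintro (_ | i)
      · intro (h : Y = ⊥)
        exact hBu.linearIndependent.ne_zero (Sum.inl ⟨0, hd⟩) (AddSubgroup.mem_bot.1 (h ▸ huY _))
      · exact (τ i).mulVec_ne_bot (hA'.linearIndependent.ne_zero (Sum.inl (Sum.inr i)))
    · choose P hP using fun k : Option (Fin d) => hA'.linearIndependent.exists_linearMap
        (k.elim (Sum.elim (Sum.elim v' 0) (Sum.elim x y))
          (fun i => Sum.elim (Sum.elim 0 (fun j => if j = i then w' j else 0)) 0))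
      have hPu : ∀ k, P none (u k) = u k := by
        rintro (i | i | i)
        · exact hP none (Sum.inl (Sum.inl i))
        · exact hP none (Sum.inr (Sum.inl i))
        · exact hP none (Sum.inr (Sum.inr i))
      have hPu' : ∀ i k, P (some i) (u k) = 0 := by
        rintro j (i | i | i)
        · exact hP (some j) (Sum.inl (Sum.inl i))
        · exact hP (some j) (Sum.inr (Sum.inl i))
        · exact hP (some j) (Sum.inr (Sum.inr i))
      have hPw : ∀ i, P none (w' i) = 0 := fun i => hP none (Sum.inl (Sum.inr i))
      have hPw' : ∀ i j, P (some i) (w' j) = if j = i then w' j else 0 :=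
        fun i j => hP (some i) (Sum.inl (Sum.inr j))
      refine iSupIndep_of_projections P ?_ ?_
      · rintro (_ | i) z hz
        · exact eq_of_mem_span_range (g := LinearMap.id) hPu (hYspan hz)
        · obtain ⟨t, -, rfl⟩ := hz
          simp [hPw']
      · rintro (_ | i) (_ | j) hij z hz
        · exact absurd rfl hij
        · obtain ⟨t, -, rfl⟩ := hz
          simp [hPw]
        · exact eq_of_mem_span_range (g := 0) (hPu' i) (hYspan hz)
        · obtain ⟨t, -, rfl⟩ := hz
          have hji : j ≠ i := fun h => hij (congrArg some h)
          simp [hPw', hji]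
    · rw [iSup_option, hXYW]
      rfl
  have hYW : Y ⊓ W = ⊥ := by
    refine ((hdec.indep none).mono_right (iSup_le fun i => ?_)).eq_bot
    exact le_iSup₂ (f := fun (k : Option (Fin d)) (_ : k ≠ none) =>
      k.elim Y (fun i => (τ i).mulVec (w' i))) (some i) (Option.some_ne_none i)
  have hu₁ : ∀ i, Sum.elim v x i ∈ X₁ := fun i => hle₁ (hA₁.vec_mem i)
  have hu₂ : ∀ i, Sum.elim w y i ∈ X₂ := fun i => hle₂ (hA₂.vec_mem i)
  have hspan₁ : X₁ ≤ (Submodule.span ℚ (Set.range (Sum.elim v x))).toAddSubgroup := fun z hz =>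
    mem_span_of_relIndex hA₁ hfin₁ hz
  have hspan₂ : X₂ ≤ (Submodule.span ℚ (Set.range (Sum.elim w y))).toAddSubgroup := fun z hz =>
    mem_span_of_relIndex hA₂ hfin₂ hz
  have hproj : ∀ E : Set (Fin d ⊕ (Fin p ⊕ Fin q)), ∃ D : V →ₗ[ℚ] V,
      IsCoordProj D (Sum.map id Sum.inl ⁻¹' E) (Sum.elim v x) ∧
      IsCoordProj D (Sum.map id Sum.inr ⁻¹' E) (Sum.elim w y) ∧ IsCoordProj D E u ∧
      ((∀ z ∈ Y, D z ∈ Y) ↔ (∀ z ∈ X₁, D z ∈ X₁) ∧ ∀ z ∈ X₂, D z ∈ X₂) := fun E => by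
    obtain ⟨D, hD₁, hD₂, hD₃, hDw⟩ := exists_isCoordProj hA.linearIndependent
      (fun i => ⟨a i, b i, rfl⟩ : ∀ i, ∃ s t : ℚ, v' i = s • v i + t • w i)
      (fun i => ⟨_, _, rfl⟩ : ∀ i, ∃ s t : ℚ, w' i = s • v i + t • w i) E
    exact ⟨D, hD₁, hD₂, hD₃, map_mem_iff hspan₁ hu₁ hspan₂ hu₂ hYspan huY hdirect hYW hXYW
      hD₁ hD₂ hD₃ hDw⟩
  refine ⟨v', w', B, Y, hA', hBu, rfl, hdec, fun hI₁ hI₂ => ?_, ?_, ?_, ?_⟩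
  · refine isIndecomposable_of_forall hBu hBY hfinY hincomparable (hdec.ne_bot none) fun E hE => ?_
    obtain ⟨D, hD₁, hD₂, hD₃, hiff⟩ := hproj E
    obtain ⟨h₁, h₂⟩ := hiff.1 (hE D hD₃)
    have hmem₁ : ∀ i j, Sum.map id Sum.inl i ∈ E → Sum.map id Sum.inl j ∈ E := fun i j hi =>
      hI₁.mem_of_mem hA₁.linearIndependent hspan₁ hu₁ hD₁ h₁ (i := i) hi
    have hmem₂ : ∀ i j, Sum.map id Sum.inr i ∈ E → Sum.map id Sum.inr j ∈ E := fun i j hi =>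
      hI₂.mem_of_mem hA₂.linearIndependent hspan₂ hu₂ hD₂ h₂ (i := i) hi
    -- The two index sets share the index `0`.
    let o : Fin d := ⟨0, hd⟩
    have hto : ∀ i ∈ E, Sum.inl o ∈ E := by
      rintro (i | i | i) hi
      · exact hmem₁ (Sum.inl i) (Sum.inl o) hi
      · exact hmem₁ (Sum.inr i) (Sum.inl o) hi
      · exact hmem₂ (Sum.inr i) (Sum.inl o) hi
    rintro i (j | j | j) hi
    · exact hmem₁ (Sum.inl o) (Sum.inl j) (hto i hi)
    · exact hmem₁ (Sum.inl o) (Sum.inr j) (hto i hi)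
    · exact hmem₂ (Sum.inl o) (Sum.inr j) (hto i hi)
  · rintro (i | i | i)
    · exact (Int.gcd_dvd_left _ _).trans
        (mul_comm e₂ e₁ ▸ mul_dvd_mul_left e₂ (hα (Sum.inl i)))
    · exact mul_comm e₂ e₁ ▸ mul_dvd_mul_left e₂ (hα (Sum.inr i))
    · exact mul_dvd_mul_left e₁ (hβ (Sum.inr i))
  · rw [Fintype.card_option, Fintype.card_fin, Fintype.card_fin]
    omega
  · intro n₁ n₂ m S₁ S₂ R hS₁ _ hS₂ _ hR hRind
    obtain ⟨b₁, hb₁, hb₁S⟩ := hS₁.exists_block hA₁ hle₁ hfin₁ hinc₁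
    obtain ⟨b₂, hb₂, hb₂S⟩ := hS₂.exists_block hA₂ hle₂ hfin₂ hinc₂
    obtain ⟨b₃, hb₃, hb₃R⟩ := hR.exists_block hBu hBY hfinY hincomparable
    have := card_blocks_le hb₁ hb₂ hb₃ fun E hE₁ hE₂ i j hij hi => by
      obtain ⟨D, hD₁, hD₂, hD₃, hiff⟩ := hproj E
      exact hR.mem_of_block_eq hBu.linearIndependent hYspan hRind hb₃R hD₃
        (hiff.2 ⟨hS₁.coordProj_mem hspan₁ hb₁S hD₁ hE₁, hS₂.coordProj_mem hspan₂ hb₂S hD₂ hE₂⟩)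
        hij hi
    simpa only [Fintype.card_fin] using this
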